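/- Let $n\ge 0$ be an integer, let $\mathcal H=(\mathbb C^2)^{\otimes n}$, and let $X|u\rangle=|u+1\rangle$, $Z|u\rangle=(-1)^u|u\rangle$ ($u\in\mathbb F_2$). For $\mu=(a,b)\in\mathbb F_2^n\times\mathbb F_2^n$ let $D_\mu=\bigotimes_{j=1}^n (-\mathrm i)^{a_jb_j}X^{a_j}Z^{b_j}$ be the $n$-qubit displacement (Pauli) operators. The $n$-qubit Clifford group is the group of all unitary operators $U$ on $\mathcal H$ such that for every $\mu$ the operator $UD_\mu U^\dagger$ equals some $D_\nu$ up to a phase factor. A pure state is a rank-one projector $|\psi\rangle\langle\psi|$ with $\|\psi\|=1$. A finite nonempty set $S$ of pure states on $\mathcal H$ is a (complex projective) $t$-design if $\sum_{\rho\in S}\rho^{\otimes t}$ is proportional to the orthogonal projector onto the symmetric subspace of $\mathcal H^{\otimes t}$. A stabilizer state is a pure state $|\psi\rangle\langle\psi|$ for which there is a subgroup $G$ of the Pauli group $\{\mathrm i^kD_\mu\}$ such that the space of vectors fixed by every element of $G$ is exactly $\mathbb C\psi$. Then, for every pure state $\rho$ on $\mathcal H$, the orbit $\{U\rho U^\dagger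 : U \text{ in the } n\text{-qubit Clifford group}\}$ is a finite set of pure states and is a complex projective $3$-design. In particular, the set of all $n$-qubit stabilizer states is finite and is a complex projective $3$-design. -/

import Mathlib

open scoped Matrix

namespace QDesign

noncomputable section

/-- The tensor product `A 0 ⊗ A 1 ⊗ ⋯ ⊗ A (m-1)` of square matrices, in the product basis. -/
def tensorProd {m : ℕ} {d : Type} (A : Fin m → Matrix d d ℂ) :
    Matrix (Fin m → d) (Fin m → d) ℂ :=
  Matrix.of fun u v => ∏ k, A k (u k) (v k)

/-- The tensor power `A ⊗ ⋯ ⊗ A` (`t` factors). -/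
def tensorPower {d : Type} (t : ℕ) (A : Matrix d d ℂ) :
    Matrix (Fin t → d) (Fin t → d) ℂ :=
  tensorProd fun _ : Fin t => A

/-- Pure states, as rank-one projectors `|ψ⟩⟨ψ|` with `ψ` a unit vector; these are the points of
the complex projective space. -/
def IsPureState {d : Type} [Fintype d] (ρ : Matrix d d ℂ) : Prop :=
  ∃ ψ : EuclideanSpace ℂ d, ‖ψ‖ = 1 ∧ ρ = Matrix.vecMulVec ψ.ofLp (star ψ.ofLp)

/-- The symmetric subspace of the `t`-partite Hilbert space `(ℂ^d)^{⊗t}`: the vectors that are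
invariant under all permutations of the `t` parties. -/
def symmetricSubspace (d : Type) [Fintype d] (t : ℕ) :
    Submodule ℂ (EuclideanSpace ℂ (Fin t → d)) where
  carrier := {v | ∀ (π : Equiv.Perm (Fin t)) (i : Fin t → d), v (i ∘ π) = v i}
  zero_mem' := by intro π i; simp
  add_mem' := by
    intro v w hv hw π i
    simp [hv π i, hw π i]
  smul_mem' := by
    intro c v hv π i
    simp [hv π i]

/-- A (finite, nonempty) set `S` of pure states is a complex projective `t`-design: the sum of
`ρ^{⊗t}` over `ρ ∈ S` is proportional to the orthogonal projector onto the symmetric subspace. -/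
def IsProjectiveDesign {d : Type} [Fintype d] [DecidableEq d] (t : ℕ)
    (S : Set (Matrix d d ℂ)) : Prop :=
  (∀ ρ ∈ S, IsPureState ρ) ∧ S.Nonempty ∧
    ∃ F : Finset (Matrix d d ℂ), (F : Set (Matrix d d ℂ)) = S ∧
      ∃ c : ℂ, Matrix.toEuclideanCLM (n := Fin t → d) (𝕜 := ℂ) (∑ ρ ∈ F, tensorPower t ρ) =
        c • (symmetricSubspace d t).starProjection

/-- The computational basis of `n` qubits. -/
abbrev Bits (n : ℕ) : Type := Fin n → ZMod 2

/-- The shift operator `X|u⟩ = |u+1⟩` of one qubit. -/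
def shiftX : Matrix (ZMod 2) (ZMod 2) ℂ := Matrix.of fun u v => if u = v + 1 then 1 else 0

/-- The phase operator `Z|u⟩ = (-1)^u |u⟩` of one qubit. -/
def phaseZ : Matrix (ZMod 2) (ZMod 2) ℂ := Matrix.diagonal fun u => (-1) ^ u.val

/-- The one-qubit displacement operators `τ^{ab} X^a Z^b`, with `τ = -e^{πi/2} = -i`. -/
def displacementOne (a b : ZMod 2) : Matrix (ZMod 2) (ZMod 2) ℂ :=
  (-Complex.I) ^ (a.val * b.val) • (shiftX ^ a.val * phaseZ ^ b.val)

/-- The `n`-qubit displacement operators (Weyl or Pauli operators)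
`D_μ = τ^{∑ a_j b_j} ∏_j X_j^{a_j} Z_j^{b_j}`, labelled by `μ = (a, b)`. -/
def displacement {n : ℕ} (μ : Bits n × Bits n) : Matrix (Bits n) (Bits n) ℂ :=
  tensorProd fun j => displacementOne (μ.1 j) (μ.2 j)

theorem displacementOne_apply (a b u v : ZMod 2) :
    displacementOne a b u v =
      if u = v + a then (-Complex.I) ^ (a.val * b.val) * (-1) ^ (b.val * v.val) else 0 := by
  have v1 : (1 : ZMod 2).val = 1 := rfl
  have v0 : (0 : ZMod 2).val = 0 := rfl
  have s11 : (1 : ZMod 2) + 1 = 0 := by decide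
  have c2 : ∀ x : ZMod 2, x = 0 ∨ x = 1 := by decide
  rcases c2 a with rfl | rfl <;> rcases c2 b with rfl | rfl <;> rcases c2 u with rfl | rfl <;>
    rcases c2 v with rfl | rfl <;>
    simp [displacementOne, phaseZ, shiftX, v0, v1, s11, Matrix.mul_diagonal]

theorem displacement_apply {n : ℕ} (μ : Bits n × Bits n) (u v : Bits n) :
    displacement μ u v = ∏ j, if u j = v j + μ.1 j then
      (-Complex.I) ^ ((μ.1 j).val * (μ.2 j).val) * (-1) ^ ((μ.2 j).val * (v j).val) else 0 := by
  simp [displacement, tensorProd, displacementOne_apply]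

theorem displacement_injective_phase {n : ℕ} {μ ν : Bits n × Bits n} {z : ℂ}
    (h : displacement μ = z • displacement ν) : μ = ν := by
  have hne : ∀ v : Bits n, displacement μ (v + μ.1) v ≠ 0 := by
    intro v
    rw [displacement_apply, Finset.prod_ne_zero_iff]
    intro j _
    simp
  have hent : ∀ u v, displacement μ u v = z * displacement ν u v := by
    intro u v
    rw [h]; simp
  have h1 : μ.1 = ν.1 := by
    funext j
    by_contra hj
    apply hne 0
    rw [hent, displacement_apply, Finset.prod_eq_zero (Finset.mem_univ j), mul_zero]
    simp [hj]
  have key : ∀ (κ : Bits n × Bits n) (j : Fin n),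
      displacement κ (Pi.single j 1 + κ.1) (Pi.single j 1) =
        (-1) ^ (κ.2 j).val * displacement κ (0 + κ.1) 0 := by
    intro κ j
    rw [displacement_apply, displacement_apply]
    simp only [Pi.add_apply, Pi.zero_apply, if_true, ZMod.val_zero, mul_zero, pow_zero, mul_one]
    rw [Finset.prod_mul_distrib, mul_comm,
      Finset.prod_eq_single (f := fun x => (-1 : ℂ) ^ ((κ.2 x).val *
        (Pi.single (M := fun _ => ZMod 2) j 1 x).val)) j]
    · simp [ZMod.val_one]
    · intro i _ hij
      simp [Pi.single_eq_of_ne hij]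
    · simp
  have h2 : μ.2 = ν.2 := by
    funext j
    have e := hent (Pi.single j 1 + μ.1) (Pi.single j 1)
    rw [key] at e
    rw [h1, key, ← h1] at e
    have e0 := hent (0 + μ.1) 0
    have e1 : ((-1 : ℂ) ^ (μ.2 j).val) = (-1) ^ (ν.2 j).val := by
      apply mul_right_cancel₀ (hne 0)
      rw [e, mul_left_comm]
      congr 1
      rw [e0]
    have c2 : ∀ x : ZMod 2, x = 0 ∨ x = 1 := by decide
    rcases c2 (μ.2 j) with hm | hm <;> rcases c2 (ν.2 j) with hn | hn <;>
      rw [hm, hn] at e1 ⊢ <;> norm_num [ZMod.val_one] at e1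
  exact Prod.ext h1 h2

/-- The `n`-qubit (full) Clifford group: all unitary operators that map displacement operators to
displacement operators up to phase factors. -/
def cliffordGroup (n : ℕ) : Subgroup (Matrix.unitaryGroup (Bits n) ℂ) where
  carrier := {U | ∀ μ : Bits n × Bits n, ∃ ν : Bits n × Bits n, ∃ z : ℂ, ‖z‖ = 1 ∧
    U.1 * displacement μ * (U.1)ᴴ = z • displacement ν}
  one_mem' := by
    intro μ
    exact ⟨μ, 1, by simp, by simp⟩
  mul_mem' := by
    intro U V hU hV μ
    obtain ⟨ν, z, hz, h⟩ := hV μ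
    obtain ⟨κ, w, hw, h'⟩ := hU ν
    refine ⟨κ, z * w, by simp [hz, hw], ?_⟩
    have : (U * V).1 * displacement μ * ((U * V).1)ᴴ =
        U.1 * (V.1 * displacement μ * (V.1)ᴴ) * (U.1)ᴴ := by
      simp [Matrix.mul_assoc]
    rw [this, h, Matrix.mul_smul, Matrix.smul_mul, h', smul_smul]
  inv_mem' := by
    intro U hU μ
    choose f z hz h using hU
    have hUU : (U.1)ᴴ * U.1 = 1 := Matrix.mem_unitaryGroup_iff'.mp U.2
    have hback : ∀ κ, displacement κ = z κ • ((U.1)ᴴ * displacement (f κ) * U.1) := by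
      intro κ
      have := congrArg (fun M => (U.1)ᴴ * M * U.1) (h κ)
      simp only [Matrix.mul_smul, Matrix.smul_mul] at this
      rw [← this]
      calc displacement κ = ((U.1)ᴴ * U.1) * displacement κ * ((U.1)ᴴ * U.1) := by
            rw [hUU]; simp
        _ = _ := by simp only [Matrix.mul_assoc]
    have hz0 : ∀ κ, z κ ≠ 0 := fun κ h0 => by
      have := hz κ
      simp [h0] at this
    have hf : Function.Injective f := by
      intro κ κ' hκ
      apply displacement_injective_phase (z := z κ * (z κ')⁻¹)
      rw [hback κ, hback κ', hκ, smul_smul, inv_mul_cancel_right₀ (hz0 κ')]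
    obtain ⟨κ, rfl⟩ := (Finite.injective_iff_surjective.mp hf) μ
    refine ⟨κ, (z κ)⁻¹, by simp [hz], ?_⟩
    rw [hback κ, smul_smul, inv_mul_cancel₀ (hz0 κ), one_smul]
    simp [Matrix.star_eq_conjTranspose]

/-- The orbit of `ρ` under the `n`-qubit Clifford group, as a set of (distinct) states. -/
def cliffordOrbit {n : ℕ} (ρ : Matrix (Bits n) (Bits n) ℂ) : Set (Matrix (Bits n) (Bits n) ℂ) :=
  {σ | ∃ U ∈ cliffordGroup n, σ = U.1 * ρ * (U.1)ᴴ}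

/-- The elements `i^k D_μ` of the `n`-qubit Pauli group. -/
def IsPauli {n : ℕ} (P : Matrix (Bits n) (Bits n) ℂ) : Prop :=
  ∃ (k : ℕ) (μ : Bits n × Bits n), P = Complex.I ^ k • displacement μ

/-- The set of `n`-qubit stabilizer states: the pure states `|ψ⟩⟨ψ|` for which some subgroup `G`
of the Pauli group has the line spanned by `ψ` as its space of fixed vectors. -/
def stabilizerStates (n : ℕ) : Set (Matrix (Bits n) (Bits n) ℂ) :=
  {ρ | ∃ ψ : EuclideanSpace ℂ (Bits n), ‖ψ‖ = 1 ∧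
    ρ = Matrix.vecMulVec ψ.ofLp (star ψ.ofLp) ∧
    ∃ G : Subgroup (Matrix.unitaryGroup (Bits n) ℂ), (∀ g ∈ G, IsPauli g.1) ∧
      ∀ v : Bits n → ℂ, (∀ g ∈ G, g.1 *ᵥ v = v) ↔ ∃ c : ℂ, v = c • ψ.ofLp}

end

end QDesign

/-!
A finite set `S` of pure states that is invariant under the Clifford group gives the operator
`A = ∑_{ρ ∈ S} ρ^{⊗3}`, which commutes with `U^{⊗3}` for every Clifford unitary `U`. It is shown
that `A` is then a scalar on the symmetric subspace; since the rows of `A` are symmetric, `A`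
vanishes on the orthogonal complement, and so `A` is proportional to the projector.

The reason is special to the third power. For a displacement operator `D = D_μ` the quarter turn
`U = (1 + i D) / √2` is a Clifford unitary (`quarterTurn_mem_cliffordGroup`), because displacement
operators are involutions that commute or anticommute. The operators `(1 + i D)^{⊗3}`,
`(1 - i D)^{⊗3}` and `D^{⊗3}` are multiples of `U^{⊗3}`, `(U†)^{⊗3}` and `(U²)^{⊗3}`, so `A` commutes
with all of them, and
`(1 + i D)^{⊗3} - (1 - i D)^{⊗3} = 2 i (D ⊗ 1 ⊗ 1 + 1 ⊗ D ⊗ 1 + 1 ⊗ 1 ⊗ D - D^{⊗3})`.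
Hence `A` commutes with the collective operator `M ⊗ 1 ⊗ 1 + 1 ⊗ M ⊗ 1 + 1 ⊗ 1 ⊗ M` for `M = D_μ`,
and, by linearity, for every matrix `M` (`commute_collective`, `span_displacement`). Newton's
identity writes `M^{⊗3}` as a polynomial in collective operators, so `A` commutes with `M^{⊗3}` for
every `M` (`commute_tensorPower_of_commute_collective`). Taking `M = |φ⟩⟨0|` shows that all vectors
`φ ⊗ φ ⊗ φ` are eigenvectors of `A` with a common eigenvalue, and they span the symmetric subspace
by polarization (`mulVec_eq_smul_of_commute_tensorPower`).

Clifford orbits are finite since conjugation by a Clifford unitary is a linear map that permutes the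
displacement operators up to signs. The set of stabilizer states is finite since a stabilizer state
is determined by a set of Pauli operators; it is nonempty, and invariant because Clifford unitaries
conjugate subgroups of the Pauli group to such subgroups.
-/

open scoped Matrix

namespace QDesign

/-! ### Tensor products of matrices -/

section TensorProd

variable {m : ℕ} {d : Type}

theorem tensorProd_mul [Fintype d] (A B : Fin m → Matrix d d ℂ) :
    tensorProd A * tensorProd B = tensorProd fun k => A k * B k := by
  ext u w
  simp only [tensorProd, Matrix.mul_apply, Matrix.of_apply, ← Finset.prod_mul_distrib]
  rw [Finset.prod_univ_sum, Fintype.piFinset_univ]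

theorem tensorProd_one [DecidableEq d] : tensorProd (fun _ : Fin m => (1 : Matrix d d ℂ)) = 1 := by
  ext u v
  by_cases h : u = v
  · subst h
    simp [tensorProd]
  · obtain ⟨k, hk⟩ := Function.ne_iff.mp h
    simp only [tensorProd, Matrix.of_apply, Matrix.one_apply_ne h]
    exact Finset.prod_eq_zero (Finset.mem_univ k) (Matrix.one_apply_ne hk)

theorem tensorProd_conjTranspose (A : Fin m → Matrix d d ℂ) :
    (tensorProd A)ᴴ = tensorProd fun k => (A k)ᴴ := by
  ext u v
  simp [tensorProd, Matrix.conjTranspose_apply]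

theorem tensorProd_smul (c : Fin m → ℂ) (A : Fin m → Matrix d d ℂ) :
    (tensorProd fun k => c k • A k) = (∏ k, c k) • tensorProd A := by
  ext u v
  simp [tensorProd, Finset.prod_mul_distrib]

theorem tensorPower_mul [Fintype d] (t : ℕ) (A B : Matrix d d ℂ) :
    tensorPower t (A * B) = tensorPower t A * tensorPower t B :=
  (tensorProd_mul _ _).symm

theorem tensorPower_smul (t : ℕ) (c : ℂ) (A : Matrix d d ℂ) :
    tensorPower t (c • A) = c ^ t • tensorPower t A := by
  simp only [tensorPower, tensorProd_smul, Finset.prod_const, Finset.card_univ, Fintype.card_fin]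

end TensorProd

/-! ### The displacement operators -/

theorem zmod_two_cases (x : ZMod 2) : x = 0 ∨ x = 1 := by
  revert x; decide

theorem zmod_two_val_one : (1 : ZMod 2).val = 1 := rfl

theorem zmod_two_one_add_one : (1 : ZMod 2) + 1 = 0 := rfl

theorem zmod_two_sum (f : ZMod 2 → ℂ) : ∑ x, f x = f 0 + f 1 := Fin.sum_univ_two f

theorem displacementOne_conjTranspose (a b : ZMod 2) :
    (displacementOne a b)ᴴ = displacementOne a b := by
  ext u v
  rcases zmod_two_cases a with rfl | rfl <;> rcases zmod_two_cases b with rfl | rfl <;>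
    rcases zmod_two_cases u with rfl | rfl <;> rcases zmod_two_cases v with rfl | rfl <;>
    simp [displacementOne_apply, Matrix.conjTranspose_apply, zmod_two_val_one, zmod_two_one_add_one]

theorem displacementOne_mul_self (a b : ZMod 2) :
    displacementOne a b * displacementOne a b = 1 := by
  ext u v
  rcases zmod_two_cases a with rfl | rfl <;> rcases zmod_two_cases b with rfl | rfl <;>
    rcases zmod_two_cases u with rfl | rfl <;> rcases zmod_two_cases v with rfl | rfl <;>
    simp [displacementOne_apply, Matrix.mul_apply, zmod_two_val_one,
      zmod_two_one_add_one]

theorem displacementOne_mul (a b a' b' : ZMod 2) : ∃ w : ℂ, ‖w‖ = 1 ∧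
    displacementOne a b * displacementOne a' b' = w • displacementOne (a + a') (b + b') := by
  have key : ∀ w : ℂ, (∀ u v, (displacementOne a b * displacementOne a' b') u v =
      w * displacementOne (a + a') (b + b') u v) →
      displacementOne a b * displacementOne a' b' = w • displacementOne (a + a') (b + b') := by
    intro w h; ext u v; simp [h]
  refine ⟨(-Complex.I) ^ (a.val * b.val + a'.val * b'.val) * (-1) ^ (b.val * a'.val) *
    Complex.I ^ ((a + a').val * (b + b').val), by simp, key _ ?_⟩
  intro u v
  rcases zmod_two_cases a with rfl | rfl <;> rcases zmod_two_cases b with rfl | rfl <;>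
  rcases zmod_two_cases a' with rfl | rfl <;> rcases zmod_two_cases b' with rfl | rfl <;>
    rcases zmod_two_cases u with rfl | rfl <;> rcases zmod_two_cases v with rfl | rfl <;>
    simp [displacementOne_apply, Matrix.mul_apply, zmod_two_val_one,
      zmod_two_one_add_one, pow_succ]

theorem displacementOne_mul_comm (a b a' b' : ZMod 2) :
    displacementOne a b * displacementOne a' b' =
      (-1 : ℂ) ^ (a.val * b'.val + b.val * a'.val) •
        (displacementOne a' b' * displacementOne a b) := by
  ext u v
  rcases zmod_two_cases a with rfl | rfl <;> rcases zmod_two_cases b with rfl | rfl <;>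
  rcases zmod_two_cases a' with rfl | rfl <;> rcases zmod_two_cases b' with rfl | rfl <;>
    rcases zmod_two_cases u with rfl | rfl <;> rcases zmod_two_cases v with rfl | rfl <;>
    simp [displacementOne_apply, Matrix.mul_apply, zmod_two_val_one,
      zmod_two_one_add_one]

/-- Fourier inversion on one qubit: a matrix unit is a combination of `X^{a+b}` and `X^{a+b} Z`. -/
theorem single_eq_sum_displacementOne (a b : ZMod 2) : ∃ w : ZMod 2 → ℂ, ∀ u v,
    ∑ c, w c * displacementOne (a + b) c u v = if u = a ∧ v = b then 1 else 0 := by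
  refine ⟨fun c => Complex.I ^ ((a + b).val * c.val) * (-1) ^ (c.val * b.val) / 2, fun u v => ?_⟩
  rw [zmod_two_sum]
  rcases zmod_two_cases a with rfl | rfl <;> rcases zmod_two_cases b with rfl | rfl <;>
    rcases zmod_two_cases u with rfl | rfl <;> rcases zmod_two_cases v with rfl | rfl <;>
    simp [displacementOne_apply, zmod_two_val_one, zmod_two_one_add_one,
      div_mul_eq_mul_div] <;> norm_num

section Displacement

variable {n : ℕ}

theorem displacement_conjTranspose (μ : Bits n × Bits n) :
    (displacement μ)ᴴ = displacement μ := by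
  simp only [displacement, tensorProd_conjTranspose, displacementOne_conjTranspose]

theorem displacement_mul_self (μ : Bits n × Bits n) : displacement μ * displacement μ = 1 := by
  simp only [displacement, tensorProd_mul, displacementOne_mul_self, tensorProd_one]

theorem displacement_mul (μ ν : Bits n × Bits n) : ∃ w : ℂ, ‖w‖ = 1 ∧
    displacement μ * displacement ν = w • displacement (μ + ν) := by
  choose w hw h using fun j => displacementOne_mul (μ.1 j) (μ.2 j) (ν.1 j) (ν.2 j)
  refine ⟨∏ j, w j, by simp [hw], ?_⟩
  simp only [displacement, tensorProd_mul, h, tensorProd_smul, Prod.fst_add, Prod.snd_add,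
    Pi.add_apply]

/-- Two displacement operators commute or anticommute. -/
theorem displacement_commute_or_anticommute (μ ν : Bits n × Bits n) :
    displacement μ * displacement ν = displacement ν * displacement μ ∨
      displacement μ * displacement ν = -(displacement ν * displacement μ) := by
  have h : displacement μ * displacement ν =
      (-1 : ℂ) ^ (∑ j, ((μ.1 j).val * (ν.2 j).val + (μ.2 j).val * (ν.1 j).val)) •
        (displacement ν * displacement μ) := by
    simp only [displacement, tensorProd_mul]
    rw [← Finset.prod_pow_eq_pow_sum, ← tensorProd_smul]
    congr 1
    funext j
    exact displacementOne_mul_comm _ _ _ _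
  rcases neg_one_pow_eq_or ℂ
    (∑ j, ((μ.1 j).val * (ν.2 j).val + (μ.2 j).val * (ν.1 j).val)) with h1 | h1 <;>
    rw [h1] at h <;> simp [h]

/-- The displacement operators span the space of all operators: the Fourier inversion formula,
taken in each tensor factor, expresses every matrix unit through them. -/
theorem span_displacement :
    Submodule.span ℂ (Set.range (displacement (n := n))) = ⊤ := by
  rw [eq_top_iff]
  rintro M -
  rw [Matrix.matrix_eq_sum_single M]
  refine Submodule.sum_mem _ fun a _ => Submodule.sum_mem _ fun b _ => ?_
  choose w hw using fun j => single_eq_sum_displacementOne (a j) (b j)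
  have h : Matrix.single a b (M a b) =
      ∑ c : Bits n, (M a b * ∏ j, w j (c j)) • displacement (a + b, c) := by
    ext u v
    simp only [Matrix.sum_apply, Matrix.smul_apply, smul_eq_mul, mul_assoc, ← Finset.mul_sum]
    have : ∑ c : Bits n, (∏ j, w j (c j)) * displacement (a + b, c) u v =
        ∏ j, if u j = a j ∧ v j = b j then (1 : ℂ) else 0 := by
      simp only [displacement, tensorProd, Matrix.of_apply, ← Finset.prod_mul_distrib, ← hw,
        Pi.add_apply]
      rw [Finset.prod_univ_sum, Fintype.piFinset_univ]
    rw [this]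
    by_cases hab : a = u ∧ b = v
    · obtain ⟨rfl, rfl⟩ := hab
      simp
    · rw [Matrix.single_apply, if_neg hab]
      obtain ⟨j, hj⟩ : ∃ j, ¬ (u j = a j ∧ v j = b j) := by
        by_contra! hcon
        exact hab ⟨funext fun j => (hcon j).1.symm, funext fun j => (hcon j).2.symm⟩
      rw [Finset.prod_eq_zero (Finset.mem_univ j) (if_neg hj), mul_zero]
  rw [h]
  exact Submodule.sum_mem _ fun c _ => Submodule.smul_mem _ _ (Submodule.subset_span ⟨_, rfl⟩)

end Displacement

/-! ### Three tensor factors -/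

section Triple

variable {d : Type}

/-- The tensor product `A ⊗ B ⊗ C`. -/
def triple (A B C : Matrix d d ℂ) : Matrix (Fin 3 → d) (Fin 3 → d) ℂ :=
  tensorProd ![A, B, C]

theorem triple_apply (A B C : Matrix d d ℂ) (u v : Fin 3 → d) :
    triple A B C u v = A (u 0) (v 0) * B (u 1) (v 1) * C (u 2) (v 2) := by
  simp only [triple, tensorProd, Matrix.of_apply, Fin.prod_univ_three]
  rfl

theorem triple_mul [Fintype d] (A B C A' B' C' : Matrix d d ℂ) :
    triple A B C * triple A' B' C' = triple (A * A') (B * B') (C * C') := by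
  simp only [triple, tensorProd_mul]
  congr 1
  funext k
  fin_cases k <;> rfl

theorem tensorPower_three (A : Matrix d d ℂ) : tensorPower 3 A = triple A A A := by
  ext u v
  simp only [triple_apply, tensorPower, tensorProd, Matrix.of_apply, Fin.prod_univ_three]

variable [DecidableEq d]

/-- The collective operator `M ⊗ 1 ⊗ 1 + 1 ⊗ M ⊗ 1 + 1 ⊗ 1 ⊗ M`, that is, the action of `M`,
seen as an element of the Lie algebra `gl(d)`, on the third tensor power. -/
def collective : Matrix d d ℂ →ₗ[ℂ] Matrix (Fin 3 → d) (Fin 3 → d) ℂ where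
  toFun M := triple M 1 1 + triple 1 M 1 + triple 1 1 M
  map_add' M N := by
    ext u v
    simp only [triple_apply, Matrix.add_apply]
    ring
  map_smul' c M := by
    ext u v
    simp only [triple_apply, Matrix.add_apply, Matrix.smul_apply, smul_eq_mul, RingHom.id_apply]
    ring

theorem collective_apply (M : Matrix d d ℂ) :
    collective M = triple M 1 1 + triple 1 M 1 + triple 1 1 M := rfl

/-- The odd part of `t ↦ (1 + t D)^{⊗3}` at `t = i` consists of the collective operator of `D` and
of `D^{⊗3}`. -/
theorem tensorPower_one_add_sub (D : Matrix d d ℂ) :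
    tensorPower 3 (1 + Complex.I • D) - tensorPower 3 (1 - Complex.I • D) =
      (2 * Complex.I) • (collective D - tensorPower 3 D) := by
  ext u v
  simp only [collective_apply, tensorPower_three, triple_apply, Matrix.add_apply, Matrix.sub_apply,
    Matrix.smul_apply, smul_eq_mul]
  linear_combination (2 * Complex.I * D (u 0) (v 0) * D (u 1) (v 1) * D (u 2) (v 2)) *
    Complex.I_mul_I

/-- Newton's identity `6 e₃ = p₁³ - 3 p₁ p₂ + 2 p₃` for the commuting operators `M ⊗ 1 ⊗ 1`,
`1 ⊗ M ⊗ 1` and `1 ⊗ 1 ⊗ M`. -/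
theorem six_smul_tensorPower_three [Fintype d] (M : Matrix d d ℂ) :
    (6 : ℂ) • tensorPower 3 M = collective M * collective M * collective M -
      (3 : ℂ) • (collective M * collective (M * M)) + (2 : ℂ) • collective (M * M * M) := by
  simp only [collective_apply, tensorPower_three, mul_add, add_mul, triple_mul, one_mul, mul_one,
    Matrix.mul_assoc]
  module

/-- An operator that commutes with all collective operators commutes with all `M^{⊗3}`. -/
theorem commute_tensorPower_of_commute_collective [Fintype d]
    {A : Matrix (Fin 3 → d) (Fin 3 → d) ℂ} (hA : ∀ M, Commute A (collective M))
    (M : Matrix d d ℂ) : Commute A (tensorPower 3 M) := by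
  have h : Commute A ((6 : ℂ) • tensorPower 3 M) := by
    rw [six_smul_tensorPower_three]
    exact ((((hA M).mul_right (hA M)).mul_right (hA M)).sub_right
      (((hA M).mul_right (hA _)).smul_right _)).add_right ((hA _).smul_right _)
  simpa [smul_smul] using h.smul_right (6⁻¹ : ℂ)

end Triple

/-! ### Operators on the symmetric subspace -/

section Symmetric

variable {d : Type} [Fintype d]

/-- Polarization of the permanent of a `3 × 3` matrix. -/
theorem sum_perm_prod_three (e : Fin 3 → Fin 3 → ℂ) :
    ∑ π : Equiv.Perm (Fin 3), ∏ k, e (π k) k =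
      ∏ k, (e 0 k + e 1 k + e 2 k) - ∏ k, (e 0 k + e 1 k) - ∏ k, (e 0 k + e 2 k) -
        ∏ k, (e 1 k + e 2 k) + ∏ k, e 0 k + ∏ k, e 1 k + ∏ k, e 2 k := by
  have h : (Finset.univ : Finset (Equiv.Perm (Fin 3))) = {1, Equiv.swap 0 1, Equiv.swap 0 2,
      Equiv.swap 1 2, finRotate 3, (finRotate 3)⁻¹} := by decide
  have h1 : ∀ k, (finRotate 3)⁻¹ k = ![2, 0, 1] k := by decide
  have h2 : ∀ k, finRotate 3 k = ![1, 2, 0] k := by decide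
  have h3 : ∀ k, Equiv.swap (0 : Fin 3) 1 k = ![1, 0, 2] k := by decide
  have h4 : ∀ k, Equiv.swap (0 : Fin 3) 2 k = ![2, 1, 0] k := by decide
  have h5 : ∀ k, Equiv.swap (1 : Fin 3) 2 k = ![0, 2, 1] k := by decide
  rw [h, Finset.sum_insert (by decide), Finset.sum_insert (by decide),
    Finset.sum_insert (by decide), Finset.sum_insert (by decide), Finset.sum_insert (by decide),
    Finset.sum_singleton]
  simp only [Fin.prod_univ_three, h1, h2, h3, h4, h5, Equiv.Perm.coe_one, id]
  simp
  ring

/-- A linear form on the third tensor power that vanishes on all `φ ⊗ φ ⊗ φ` vanishes on the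
symmetric subspace. -/
theorem sum_mul_eq_zero_of_symmetric [DecidableEq d] {c v : (Fin 3 → d) → ℂ}
    (hc : ∀ φ : d → ℂ, ∑ y, c y * ∏ k, φ (y k) = 0)
    (hv : ∀ (π : Equiv.Perm (Fin 3)) (y : Fin 3 → d), v (y ∘ π) = v y) :
    ∑ y, c y * v y = 0 := by
  let e : (Fin 3 → d) → (Fin 3 → d) → Fin 3 → Fin 3 → ℂ := fun z y i k => if y k = z i then 1 else 0
  -- The symmetrization of a basis vector, as a function of both indices.
  let P : (Fin 3 → d) → (Fin 3 → d) → ℂ := fun z y => ∑ π : Equiv.Perm (Fin 3), ∏ k, e z y (π k) k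
  have hP : ∀ z, ∑ y, c y * P z y = 0 := by
    intro z
    simp only [P, sum_perm_prod_three, mul_add, mul_sub, Finset.sum_add_distrib,
      Finset.sum_sub_distrib]
    have h3 := hc fun a => (if a = z 0 then 1 else 0) + (if a = z 1 then 1 else 0) +
      (if a = z 2 then 1 else 0)
    have h01 := hc fun a => (if a = z 0 then 1 else 0) + (if a = z 1 then 1 else 0)
    have h02 := hc fun a => (if a = z 0 then 1 else 0) + (if a = z 2 then 1 else 0)
    have h12 := hc fun a => (if a = z 1 then 1 else 0) + (if a = z 2 then 1 else 0)
    have h0 := hc fun a => if a = z 0 then 1 else 0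
    have h1 := hc fun a => if a = z 1 then 1 else 0
    have h2 := hc fun a => if a = z 2 then 1 else 0
    simp only [e]
    rw [h3, h01, h02, h12, h0, h1, h2]
    simp
  have hvP : ∀ y, ∑ z, v z * P z y = 6 * v y := by
    intro y
    simp only [P, Finset.mul_sum]
    rw [Finset.sum_comm]
    have hπ : ∀ π : Equiv.Perm (Fin 3), ∑ z, v z * ∏ k, e z y (π k) k = v y := by
      intro π
      rw [Finset.sum_eq_single (y ∘ ⇑π⁻¹)]
      · simp [e, hv]
      · intro z _ hz
        obtain ⟨k, hk⟩ : ∃ k, y k ≠ z (π k) := by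
          by_contra! hcon
          exact hz (funext fun k => by simp [hcon])
        rw [Finset.prod_eq_zero (Finset.mem_univ k) (if_neg hk), mul_zero]
      · simp
    simp [hπ, Fintype.card_perm, Nat.factorial]
  have h6 : 6 * ∑ y, c y * v y = 0 := by
    calc 6 * ∑ y, c y * v y = ∑ y, c y * ∑ z, v z * P z y := by
          rw [Finset.mul_sum]
          exact Finset.sum_congr rfl fun y _ => by rw [hvP]; ring
      _ = ∑ z, v z * ∑ y, c y * P z y := by
          simp only [Finset.mul_sum]
          rw [Finset.sum_comm]
          exact Finset.sum_congr rfl fun z _ => Finset.sum_congr rfl fun y _ => by ring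
      _ = 0 := by simp [hP]
  simpa using h6

/-- An operator that commutes with all `M^{⊗3}` is a scalar on the symmetric subspace. The rank-one
operators `M = |φ⟩⟨o|` show that `φ^{⊗3}` is an eigenvector with the eigenvalue `⟨ooo|A|ooo⟩`. -/
theorem mulVec_eq_smul_of_commute_tensorPower [DecidableEq d]
    {A : Matrix (Fin 3 → d) (Fin 3 → d) ℂ}
    (hA : ∀ M : Matrix d d ℂ, Commute A (tensorPower 3 M)) (o : d)
    {v : (Fin 3 → d) → ℂ}
    (hv : ∀ (π : Equiv.Perm (Fin 3)) (y : Fin 3 → d), v (y ∘ π) = v y) :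
    A *ᵥ v = A (fun _ => o) (fun _ => o) • v := by
  set α := A (fun _ => o) (fun _ => o) with hα
  have heig : ∀ (φ : d → ℂ) (x : Fin 3 → d),
      ∑ y, A x y * ∏ k, φ (y k) = α * ∏ k, φ (x k) := by
    intro φ x
    have h := congrFun₂ (hA (Matrix.vecMulVec φ (Pi.single o 1))).eq x (fun _ => o)
    simp only [Matrix.mul_apply, tensorPower, tensorProd, Matrix.of_apply,
      Matrix.vecMulVec_apply, Pi.single_eq_same, mul_one] at h
    rw [h, Finset.sum_eq_single fun _ => o]
    · simp [hα, mul_comm]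
    · intro y _ hy
      obtain ⟨k, hk⟩ := Function.ne_iff.mp hy
      rw [Finset.prod_eq_zero (Finset.mem_univ k), zero_mul]
      simp [Pi.single_eq_of_ne hk]
    · simp
  funext x
  have h := sum_mul_eq_zero_of_symmetric (c := fun y => A x y - α * (1 : Matrix _ _ ℂ) x y)
    (fun φ => by simp [sub_mul, Finset.sum_sub_distrib, heig, Matrix.one_apply]) hv
  simpa [sub_mul, Finset.sum_sub_distrib, Matrix.one_apply, sub_eq_zero, Matrix.mulVec,
    dotProduct] using h

/-- The entries of `ρ^{⊗t}`, for a pure state `ρ`, are symmetric in the column index. -/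
theorem IsPureState.tensorPower_apply_comp {ρ : Matrix d d ℂ} (hρ : IsPureState ρ) (t : ℕ)
    (π : Equiv.Perm (Fin t)) (x y : Fin t → d) :
    tensorPower t ρ x (y ∘ π) = tensorPower t ρ x y := by
  obtain ⟨ψ, -, rfl⟩ := hρ
  simp only [tensorPower, tensorProd, Matrix.of_apply, Matrix.vecMulVec_apply,
    Finset.prod_mul_distrib, Function.comp_apply]
  rw [Equiv.prod_comp π fun k => star ψ.ofLp (y k)]

/-- An operator whose rows are symmetric and that acts as a scalar on the symmetric subspace is
proportional to the projector onto that subspace. -/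
theorem toEuclideanCLM_eq_smul_starProjection [DecidableEq d] {t : ℕ}
    {A : Matrix (Fin t → d) (Fin t → d) ℂ}
    (hrow : ∀ (π : Equiv.Perm (Fin t)) (x y : Fin t → d), A x (y ∘ π) = A x y) {α : ℂ}
    (hα : ∀ v : (Fin t → d) → ℂ, (∀ (π : Equiv.Perm (Fin t)) (y : Fin t → d), v (y ∘ π) = v y) →
      A *ᵥ v = α • v) :
    Matrix.toEuclideanCLM (n := Fin t → d) (𝕜 := ℂ) A =
      α • (symmetricSubspace d t).starProjection := by
  ext1 v
  set p := (symmetricSubspace d t).starProjection v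
  have hp : p ∈ symmetricSubspace d t := Submodule.starProjection_apply_mem _ v
  have hw : v - p ∈ (symmetricSubspace d t)ᗮ := Submodule.sub_starProjection_mem_orthogonal v
  have h1 : A *ᵥ (v - p).ofLp = 0 := by
    funext x
    have hx : WithLp.toLp 2 (fun y => star (A x y)) ∈ symmetricSubspace d t :=
      fun π y => by simp [hrow]
    have := (Submodule.mem_orthogonal _ _).mp hw _ hx
    simpa [PiLp.inner_apply, Matrix.mulVec, dotProduct, mul_comm] using this
  have h2 := hα p.ofLp hp
  have h3 : A *ᵥ v.ofLp = α • p.ofLp := by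
    rw [← h2, ← sub_eq_zero, ← Matrix.mulVec_sub]
    exact h1
  refine (WithLp.ofLp_injective 2) ?_
  rw [Matrix.ofLp_toEuclideanCLM, h3]
  rfl

end Symmetric

/-! ### Pure states -/

section PureState

variable {d : Type} [Fintype d] [DecidableEq d]

omit [DecidableEq d] in
theorem norm_eq_one_iff_dotProduct (ψ : EuclideanSpace ℂ d) :
    ‖ψ‖ = 1 ↔ star ψ.ofLp ⬝ᵥ ψ.ofLp = 1 := by
  have h : star ψ.ofLp ⬝ᵥ ψ.ofLp = ((‖ψ‖ ^ 2 : ℝ) : ℂ) := by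
    rw [dotProduct_comm, ← EuclideanSpace.inner_eq_star_dotProduct, inner_self_eq_norm_sq_to_K]
    norm_cast
  rw [h]
  norm_cast
  exact (pow_eq_one_iff_of_nonneg (norm_nonneg ψ) two_ne_zero).symm

theorem norm_unitary_mulVec (U : Matrix.unitaryGroup d ℂ) {ψ : EuclideanSpace ℂ d}
    (hψ : ‖ψ‖ = 1) : ‖(WithLp.toLp 2 (U.1 *ᵥ ψ.ofLp) : EuclideanSpace ℂ d)‖ = 1 := by
  rw [norm_eq_one_iff_dotProduct] at hψ ⊢
  have hU : (U.1)ᴴ * U.1 = 1 := Matrix.mem_unitaryGroup_iff'.mp U.2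
  rw [Matrix.star_mulVec, Matrix.dotProduct_mulVec, Matrix.vecMul_vecMul, hU, Matrix.vecMul_one, hψ]

omit [DecidableEq d] in
theorem conj_vecMulVec (U : Matrix d d ℂ) (ψ : d → ℂ) :
    U * Matrix.vecMulVec ψ (star ψ) * Uᴴ = Matrix.vecMulVec (U *ᵥ ψ) (star (U *ᵥ ψ)) := by
  rw [Matrix.mul_vecMulVec, Matrix.vecMulVec_mul, Matrix.star_mulVec]

theorem IsPureState.conj {ρ : Matrix d d ℂ} (hρ : IsPureState ρ)
    (U : Matrix.unitaryGroup d ℂ) : IsPureState (U.1 * ρ * (U.1)ᴴ) := by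
  obtain ⟨ψ, hψ, rfl⟩ := hρ
  exact ⟨WithLp.toLp 2 (U.1 *ᵥ ψ.ofLp), norm_unitary_mulVec U hψ, conj_vecMulVec _ _⟩

end PureState

/-! ### Clifford unitaries -/

section Clifford

variable {n : ℕ}

theorem one_add_mul_one_sub_displacement (μ : Bits n × Bits n) :
    (1 + Complex.I • displacement μ) * (1 - Complex.I • displacement μ) = (2 : ℂ) • 1 := by
  have h := displacement_mul_self μ
  simp only [mul_sub, add_mul, one_mul, mul_one, Matrix.smul_mul, Matrix.mul_smul, h, smul_smul,
    Complex.I_mul_I]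
  module

theorem one_add_mul_self_displacement (μ : Bits n × Bits n) :
    (1 + Complex.I • displacement μ) * (1 + Complex.I • displacement μ) =
      (2 * Complex.I) • displacement μ := by
  have h := displacement_mul_self μ
  simp only [mul_add, add_mul, one_mul, mul_one, Matrix.smul_mul, Matrix.mul_smul, h, smul_smul,
    Complex.I_mul_I]
  module

theorem conjTranspose_one_add_displacement (μ : Bits n × Bits n) :
    (1 + Complex.I • displacement μ)ᴴ = 1 - Complex.I • displacement μ := by
  simp [Matrix.conjTranspose_smul, displacement_conjTranspose, sub_eq_add_neg]

theorem sqrt_two_inv_mul_self : (((√2)⁻¹ : ℝ) : ℂ) * (((√2)⁻¹ : ℝ) : ℂ) = 2⁻¹ := by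
  rw [← Complex.ofReal_mul, ← mul_inv, Real.mul_self_sqrt zero_le_two]
  norm_num

/-- The quarter turn `(1 + i D_μ) / √2 = exp(i π D_μ / 4)` about the displacement operator `D_μ`.
On the phase space, conjugation by it is the symplectic transvection along `μ`. -/
noncomputable def quarterTurn (μ : Bits n × Bits n) : Matrix.unitaryGroup (Bits n) ℂ :=
  ⟨(((√2)⁻¹ : ℝ) : ℂ) • (1 + Complex.I • displacement μ), by
    rw [Matrix.mem_unitaryGroup_iff, Matrix.star_eq_conjTranspose, Matrix.conjTranspose_smul,
      conjTranspose_one_add_displacement, Matrix.smul_mul, Matrix.mul_smul,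
      one_add_mul_one_sub_displacement, smul_smul, smul_smul, Complex.star_def, Complex.conj_ofReal,
      sqrt_two_inv_mul_self]
    simp⟩

theorem quarterTurn_coe (μ : Bits n × Bits n) : (quarterTurn μ).1 =
    (((√2)⁻¹ : ℝ) : ℂ) • (1 + Complex.I • displacement μ) := rfl

theorem quarterTurn_conjTranspose (μ : Bits n × Bits n) : ((quarterTurn μ).1)ᴴ =
    (((√2)⁻¹ : ℝ) : ℂ) • (1 - Complex.I • displacement μ) := by
  rw [quarterTurn_coe, Matrix.conjTranspose_smul, conjTranspose_one_add_displacement,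
    Complex.star_def, Complex.conj_ofReal]

theorem quarterTurn_mem_cliffordGroup (μ : Bits n × Bits n) :
    quarterTurn μ ∈ cliffordGroup n := by
  intro ν
  set D := displacement μ with hD
  set E := displacement ν with hE
  have hsq := one_add_mul_self_displacement μ
  have hone := one_add_mul_one_sub_displacement μ
  rw [← hD] at hsq hone
  have hconj : (quarterTurn μ).1 * E * ((quarterTurn μ).1)ᴴ =
      (2⁻¹ : ℂ) • ((1 + Complex.I • D) * (E * (1 - Complex.I • D))) := by
    rw [quarterTurn_conjTranspose, quarterTurn_coe, Matrix.smul_mul, Matrix.smul_mul,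
      Matrix.mul_smul, smul_smul, sqrt_two_inv_mul_self, Matrix.mul_assoc]
  rcases displacement_commute_or_anticommute μ ν with h | h
  · refine ⟨ν, 1, by simp, ?_⟩
    have hE' : E * (1 - Complex.I • D) = (1 - Complex.I • D) * E := by
      simp [mul_sub, sub_mul, hD, hE, h]
    rw [hconj, hE', ← Matrix.mul_assoc, hone]
    simp [smul_smul, hE]
  · obtain ⟨w, hw, hμν⟩ := displacement_mul μ ν
    refine ⟨μ + ν, Complex.I * w, by simp [hw], ?_⟩
    have hE' : E * (1 - Complex.I • D) = (1 + Complex.I • D) * E := by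
      simp [mul_add, add_mul, hD, hE, h, sub_eq_add_neg]
    rw [hconj, hE', ← Matrix.mul_assoc, hsq, Matrix.smul_mul, hμν, smul_smul, smul_smul]
    congr 1
    ring

/-- The phase factors in the definition of the Clifford group are signs, because displacement
operators are involutions. -/
theorem conj_displacement_eq_or_eq_neg {U : Matrix.unitaryGroup (Bits n) ℂ}
    (hU : U ∈ cliffordGroup n) (μ : Bits n × Bits n) :
    ∃ ν, U.1 * displacement μ * (U.1)ᴴ = displacement ν ∨
      U.1 * displacement μ * (U.1)ᴴ = -displacement ν := by
  obtain ⟨ν, z, -, h⟩ := hU μ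
  have hUU : (U.1)ᴴ * U.1 = 1 := Matrix.mem_unitaryGroup_iff'.mp U.2
  have hUU' : U.1 * (U.1)ᴴ = 1 := Matrix.mem_unitaryGroup_iff.mp U.2
  have hsq : (U.1 * displacement μ * (U.1)ᴴ) * (U.1 * displacement μ * (U.1)ᴴ) = 1 := by
    calc _ = U.1 * (displacement μ * ((U.1)ᴴ * U.1) * displacement μ) * (U.1)ᴴ := by
          simp only [Matrix.mul_assoc]
      _ = 1 := by rw [hUU, mul_one, displacement_mul_self, mul_one, hUU']
  rw [h, Matrix.smul_mul, Matrix.mul_smul, displacement_mul_self, smul_smul] at hsq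
  have hz : z * z = 1 := by simpa using congrFun₂ hsq 0 0
  refine ⟨ν, ?_⟩
  rcases mul_self_eq_one_iff.mp hz with rfl | rfl
  · exact Or.inl (by simpa using h)
  · exact Or.inr (by simpa using h)

/-- The Clifford group is finite up to phases: conjugation by a Clifford unitary is a linear map,
so it is determined by the finitely many possible images of the displacement operators. -/
theorem cliffordOrbit_finite (ρ : Matrix (Bits n) (Bits n) ℂ) : (cliffordOrbit ρ).Finite := by
  let Φ : Matrix.unitaryGroup (Bits n) ℂ →
      (Matrix (Bits n) (Bits n) ℂ →ₗ[ℂ] Matrix (Bits n) (Bits n) ℂ) := fun U =>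
    LinearMap.mulRight ℂ (U.1)ᴴ ∘ₗ LinearMap.mulLeft ℂ U.1
  have hfin : (Φ '' (cliffordGroup n : Set (Matrix.unitaryGroup (Bits n) ℂ))).Finite := by
    have ht : {f : Bits n × Bits n → Matrix (Bits n) (Bits n) ℂ | ∀ μ, f μ ∈
        Set.range displacement ∪ Set.range fun ν => -displacement ν}.Finite :=
      Set.Finite.pi' fun _ => (Set.finite_range _).union (Set.finite_range _)
    refine Set.Finite.of_injOn (f := fun L μ => L (displacement μ)) ?_ ?_ ht
    · rintro _ ⟨U, hU, rfl⟩ μ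
      obtain ⟨ν, h | h⟩ := conj_displacement_eq_or_eq_neg hU μ
      · exact Or.inl ⟨ν, h.symm⟩
      · exact Or.inr ⟨ν, h.symm⟩
    · intro L _ L' _ h
      exact LinearMap.ext_on_range span_displacement (congrFun h)
  refine (hfin.image fun L => L ρ).subset ?_
  rintro _ ⟨U, hU, rfl⟩
  exact ⟨Φ U, ⟨U, hU, rfl⟩, rfl⟩

end Clifford

/-! ### Clifford-invariant sets of states -/

section Invariant

variable {n : ℕ}

theorem commute_sum_tensorPower (t : ℕ) {F : Finset (Matrix (Bits n) (Bits n) ℂ)}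
    (hF : ∀ U ∈ cliffordGroup n, ∀ ρ ∈ F, U.1 * ρ * (U.1)ᴴ ∈ F)
    {U : Matrix.unitaryGroup (Bits n) ℂ} (hU : U ∈ cliffordGroup n) :
    Commute (∑ ρ ∈ F, tensorPower t ρ) (tensorPower t U.1) := by
  have hUU : (U.1)ᴴ * U.1 = 1 := Matrix.mem_unitaryGroup_iff'.mp U.2
  have hUU' : U.1 * (U.1)ᴴ = 1 := Matrix.mem_unitaryGroup_iff.mp U.2
  simp only [Commute, SemiconjBy, Finset.sum_mul, Finset.mul_sum, ← tensorPower_mul]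
  refine Finset.sum_nbij' (fun ρ => (U.1)ᴴ * ρ * U.1) (fun ρ => U.1 * ρ * (U.1)ᴴ) ?_ (hF U hU)
    ?_ ?_ ?_
  · intro ρ hρ
    simpa [Matrix.star_eq_conjTranspose] using hF U⁻¹ (inv_mem hU) ρ hρ
  · intro ρ _
    calc _ = (U.1 * (U.1)ᴴ) * ρ * (U.1 * (U.1)ᴴ) := by simp only [Matrix.mul_assoc]
      _ = ρ := by rw [hUU', one_mul, mul_one]
  · intro ρ _
    calc _ = ((U.1)ᴴ * U.1) * ρ * ((U.1)ᴴ * U.1) := by simp only [Matrix.mul_assoc]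
      _ = ρ := by rw [hUU, one_mul, mul_one]
  · intro ρ _
    rw [← Matrix.mul_assoc, ← Matrix.mul_assoc, hUU', one_mul]

/-- The step from the Clifford group to the whole Lie algebra: an operator on three copies that
commutes with `U^{⊗3}` for all Clifford unitaries `U` commutes with all collective operators. For
`D = D_μ` this follows from the quarter turn about `D`, whose tensor cube has the collective
operator of `D` as a combination of it, its adjoint and its square; the `D_μ` span. -/
theorem commute_collective {A : Matrix (Fin 3 → Bits n) (Fin 3 → Bits n) ℂ}
    (hA : ∀ U ∈ cliffordGroup n, Commute A (tensorPower 3 U.1))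
    (M : Matrix (Bits n) (Bits n) ℂ) : Commute A (collective M) := by
  have hc : (((√2)⁻¹ : ℝ) : ℂ) ^ 3 ≠ 0 := by simp
  have hcancel : ∀ {c : ℂ} {B : Matrix (Fin 3 → Bits n) (Fin 3 → Bits n) ℂ}, c ≠ 0 →
      Commute A (c • B) → Commute A B := by
    intro c B hc h
    simpa [smul_smul, hc] using h.smul_right c⁻¹
  have hD : ∀ μ : Bits n × Bits n, Commute A (collective (displacement μ)) := by
    intro μ
    have hplus : Commute A (tensorPower 3 (1 + Complex.I • displacement μ)) := by
      have h := hA _ (quarterTurn_mem_cliffordGroup μ)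
      rw [quarterTurn_coe, tensorPower_smul] at h
      exact hcancel hc h
    have hminus : Commute A (tensorPower 3 (1 - Complex.I • displacement μ)) := by
      have h := hA _ (inv_mem (quarterTurn_mem_cliffordGroup μ))
      rw [Matrix.UnitaryGroup.inv_val, Matrix.star_eq_conjTranspose, quarterTurn_conjTranspose,
        tensorPower_smul] at h
      exact hcancel hc h
    have hcube : Commute A (tensorPower 3 (displacement μ)) := by
      have h := hplus.mul_right hplus
      rw [← tensorPower_mul, one_add_mul_self_displacement, tensorPower_smul] at h
      exact hcancel (by simp) h
    have h := hplus.sub_right hminus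
    rw [tensorPower_one_add_sub] at h
    simpa using (hcancel (by simp) h).add_right hcube
  have hM : M ∈ Submodule.span ℂ (Set.range (displacement (n := n))) := by
    rw [span_displacement]
    trivial
  induction hM using Submodule.span_induction with
  | mem M h =>
    obtain ⟨μ, rfl⟩ := h
    exact hD μ
  | zero => simp
  | add M N _ _ hM hN =>
    rw [map_add]
    exact hM.add_right hN
  | smul c M _ hM =>
    rw [map_smul]
    exact hM.smul_right c

theorem isProjectiveDesign_three_of_invariant {S : Set (Matrix (Bits n) (Bits n) ℂ)}
    (hfin : S.Finite) (hne : S.Nonempty) (hpure : ∀ ρ ∈ S, IsPureState ρ)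
    (hS : ∀ U ∈ cliffordGroup n, ∀ ρ ∈ S, U.1 * ρ * (U.1)ᴴ ∈ S) :
    IsProjectiveDesign 3 S := by
  obtain ⟨F, rfl⟩ := hfin.exists_finset_coe
  refine ⟨hpure, hne, F, rfl,
    (∑ ρ ∈ F, tensorPower 3 ρ) (fun _ => 0) (fun _ => 0),
    toEuclideanCLM_eq_smul_starProjection ?_ ?_⟩
  · intro π x y
    simp only [Matrix.sum_apply]
    exact Finset.sum_congr rfl fun ρ hρ => (hpure ρ hρ).tensorPower_apply_comp 3 π x y
  · intro v hv
    exact mulVec_eq_smul_of_commute_tensorPower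
      (commute_tensorPower_of_commute_collective
        (commute_collective fun U hU => commute_sum_tensorPower 3 hS hU)) 0 hv

theorem isProjectiveDesign_three_cliffordOrbit {ρ : Matrix (Bits n) (Bits n) ℂ}
    (hρ : IsPureState ρ) : IsProjectiveDesign 3 (cliffordOrbit ρ) := by
  refine isProjectiveDesign_three_of_invariant (cliffordOrbit_finite ρ)
    ⟨ρ, 1, one_mem _, by simp⟩ ?_ ?_
  · rintro _ ⟨U, -, rfl⟩
    exact hρ.conj U
  · rintro U hU _ ⟨V, hV, rfl⟩
    exact ⟨U * V, mul_mem hU hV, by simp [Matrix.mul_assoc]⟩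

end Invariant

/-! ### Stabilizer states -/

section Stabilizer

variable {n : ℕ}

theorem finite_setOf_isPauli : {P : Matrix (Bits n) (Bits n) ℂ | IsPauli P}.Finite := by
  refine (Set.finite_range fun p : Fin 4 × (Bits n × Bits n) =>
    Complex.I ^ (p.1 : ℕ) • displacement p.2).subset ?_
  rintro _ ⟨k, μ, rfl⟩
  refine ⟨(⟨k % 4, Nat.mod_lt _ (by norm_num)⟩, μ), ?_⟩
  simp only [Complex.I_pow_eq_pow_mod k]

/-- A stabilizer state is determined by its set of Pauli stabilizers, of which there are finitely
many. -/
theorem stabilizerStates_finite : (stabilizerStates n).Finite := by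
  have h : ∀ ρ : stabilizerStates n, ∃ Q : {Q : Set (Matrix (Bits n) (Bits n) ℂ) //
      Q ⊆ {P | IsPauli P}}, ∃ ψ : EuclideanSpace ℂ (Bits n), ‖ψ‖ = 1 ∧
      ρ.1 = Matrix.vecMulVec ψ.ofLp (star ψ.ofLp) ∧
      ∀ v : Bits n → ℂ, (∀ P ∈ Q.1, P *ᵥ v = v) ↔ ∃ c : ℂ, v = c • ψ.ofLp := by
    rintro ⟨ρ, ψ, hψ, hρ, G, hG, hfix⟩
    refine ⟨⟨Subtype.val '' (G : Set (Matrix.unitaryGroup (Bits n) ℂ)), ?_⟩, ψ, hψ, hρ, ?_⟩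
    · rintro _ ⟨g, hg, rfl⟩
      exact hG g hg
    · simpa using hfix
  choose Q hQ using h
  have : Finite {Q : Set (Matrix (Bits n) (Bits n) ℂ) // Q ⊆ {P | IsPauli P}} :=
    finite_setOf_isPauli.finite_subsets
  refine Finite.of_injective Q fun ρ ρ' hρρ' => ?_
  obtain ⟨ψ, hψ, hρ, hfix⟩ := hQ ρ
  obtain ⟨ψ', hψ', hρ', hfix'⟩ := hQ ρ'
  rw [hρρ'] at hfix
  obtain ⟨c, hc⟩ := (hfix ψ'.ofLp).mp ((hfix' ψ'.ofLp).mpr ⟨1, by simp⟩)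
  have hcψ : ψ' = c • ψ := WithLp.ofLp_injective 2 hc
  -- Both vectors are unit vectors, so `c` is a phase and drops out of the projector.
  have hc1 : c * star c = 1 := by
    have : ‖c‖ = 1 := by simpa [hcψ, norm_smul, hψ] using hψ'
    rw [Complex.star_def, Complex.mul_conj, Complex.normSq_eq_norm_sq, this]
    norm_num
  apply Subtype.ext
  rw [hρ, hρ', hc, star_smul, Matrix.vecMulVec_smul, Matrix.smul_vecMulVec, smul_smul, mul_comm,
    hc1, one_smul]

theorem stabilizerStates_conj {U : Matrix.unitaryGroup (Bits n) ℂ} (hU : U ∈ cliffordGroup n)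
    {ρ : Matrix (Bits n) (Bits n) ℂ} (hρ : ρ ∈ stabilizerStates n) :
    U.1 * ρ * (U.1)ᴴ ∈ stabilizerStates n := by
  obtain ⟨ψ, hψ, rfl, G, hG, hfix⟩ := hρ
  have hUU : (U.1)ᴴ * U.1 = 1 := Matrix.mem_unitaryGroup_iff'.mp U.2
  have hUU' : U.1 * (U.1)ᴴ = 1 := Matrix.mem_unitaryGroup_iff.mp U.2
  refine ⟨WithLp.toLp 2 (U.1 *ᵥ ψ.ofLp), norm_unitary_mulVec U hψ, conj_vecMulVec _ _,
    G.map (MulAut.conj U).toMonoidHom, ?_, ?_⟩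
  · rintro _ ⟨g, hg, rfl⟩
    obtain ⟨k, μ, hk⟩ := hG g hg
    have hconj : ((MulAut.conj U).toMonoidHom g).1 =
        Complex.I ^ k • (U.1 * displacement μ * (U.1)ᴴ) := by
      simp [hk, Matrix.star_eq_conjTranspose]
    obtain ⟨ν, h | h⟩ := conj_displacement_eq_or_eq_neg hU μ
    · exact ⟨k, ν, by rw [hconj, h]⟩
    · exact ⟨k + 2, ν, by rw [hconj, h, pow_add, Complex.I_sq]; simp⟩
  · intro v
    have hmove : ∀ u w : Bits n → ℂ, (U.1)ᴴ *ᵥ u = w ↔ u = U.1 *ᵥ w := by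
      intro u w
      constructor
      · rintro rfl
        rw [Matrix.mulVec_mulVec, hUU', Matrix.one_mulVec]
      · rintro rfl
        rw [Matrix.mulVec_mulVec, hUU, Matrix.one_mulVec]
    have h1 : (∀ g ∈ G.map (MulAut.conj U).toMonoidHom, g.1 *ᵥ v = v) ↔
        ∀ g ∈ G, g.1 *ᵥ ((U.1)ᴴ *ᵥ v) = (U.1)ᴴ *ᵥ v := by
      simp only [Subgroup.mem_map, forall_exists_index, and_imp, forall_apply_eq_imp_iff₂]
      refine forall₂_congr fun g _ => ?_
      have hconj : ((MulAut.conj U).toMonoidHom g).1 = U.1 * (g.1 * (U.1)ᴴ) := by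
        simp [Matrix.star_eq_conjTranspose, Matrix.mul_assoc]
      rw [hconj, ← Matrix.mulVec_mulVec, ← Matrix.mulVec_mulVec, eq_comm, ← hmove, eq_comm]
    rw [h1, hfix]
    refine exists_congr fun c => ?_
    rw [hmove, Matrix.mulVec_smul]

theorem displacement_zero_left (b : Bits n) :
    displacement (0, b) = Matrix.diagonal fun v => ∏ j, (-1 : ℂ) ^ ((b j).val * (v j).val) := by
  ext u v
  rw [displacement_apply, Matrix.diagonal_apply]
  by_cases h : u = v
  · subst h
    simp
  · obtain ⟨j, hj⟩ := Function.ne_iff.mp h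
    rw [if_neg h]
    exact Finset.prod_eq_zero (Finset.mem_univ j) (if_neg (by simpa using hj))

theorem displacement_zero_left_mul (b b' : Bits n) :
    displacement (0, b) * displacement (0, b') = displacement (0, b + b') := by
  rw [displacement_zero_left, displacement_zero_left, displacement_zero_left,
    Matrix.diagonal_mul_diagonal]
  congr 1
  funext v
  rw [← Finset.prod_mul_distrib]
  refine Finset.prod_congr rfl fun j _ => ?_
  simp only [Pi.add_apply]
  rcases zmod_two_cases (b j) with h | h <;> rcases zmod_two_cases (b' j) with h' | h' <;>
    simp [h, h', zmod_two_val_one, zmod_two_one_add_one, ← mul_pow]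

/-- The group `{Z^b}` of phase-type displacement operators, the stabilizer of `|0⋯0⟩`. -/
def phaseGroup (n : ℕ) : Subgroup (Matrix.unitaryGroup (Bits n) ℂ) where
  carrier := {U | ∃ b : Bits n, U.1 = displacement (0, b)}
  one_mem' := ⟨0, by simp [displacement_zero_left]⟩
  mul_mem' := by
    rintro U V ⟨b, hb⟩ ⟨b', hb'⟩
    exact ⟨b + b', by simp [hb, hb', displacement_zero_left_mul]⟩
  inv_mem' := by
    rintro U ⟨b, hb⟩
    exact ⟨b, by simp [hb, Matrix.star_eq_conjTranspose, displacement_conjTranspose]⟩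

theorem stabilizerStates_nonempty : (stabilizerStates n).Nonempty := by
  refine ⟨_, EuclideanSpace.single 0 1, by simp, rfl, phaseGroup n, ?_, ?_⟩
  · rintro g ⟨b, hb⟩
    exact ⟨0, (0, b), by simp [hb]⟩
  · intro v
    constructor
    · intro h
      refine ⟨v 0, funext fun u => ?_⟩
      by_cases hu : u = 0
      · simp [hu]
      obtain ⟨j, hj⟩ := Function.ne_iff.mp hu
      have hj1 : u j = 1 := (zmod_two_cases (u j)).resolve_left hj
      let b : Bits n := Pi.single j 1
      have hmem : displacement (0, b) ∈ Matrix.unitaryGroup (Bits n) ℂ := by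
        rw [Matrix.mem_unitaryGroup_iff, Matrix.star_eq_conjTranspose,
          displacement_conjTranspose, displacement_mul_self]
      -- `Z_j` multiplies the `u`-th coordinate by `-1`.
      have hv : (displacement (0, b) *ᵥ v) u = v u := congrFun (h ⟨_, hmem⟩ ⟨b, rfl⟩) u
      have hsign : ∏ i, (-1 : ℂ) ^ ((b i).val * (u i).val) = -1 := by
        rw [Finset.prod_eq_single j]
        · simp [b, hj1, zmod_two_val_one]
        · intro i _ hij
          simp [b, Pi.single_eq_of_ne hij]
        · simp
      rw [displacement_zero_left, Matrix.mulVec_diagonal, hsign] at hv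
      have : v u = 0 := by linear_combination (-1 / 2 : ℂ) * hv
      simp [this, hu]
    · rintro ⟨c, rfl⟩ g ⟨b, hb⟩
      rw [hb, displacement_zero_left]
      funext u
      rw [Matrix.mulVec_diagonal]
      by_cases hu : u = 0 <;> simp [hu]

theorem isProjectiveDesign_three_stabilizerStates :
    IsProjectiveDesign 3 (stabilizerStates n) := by
  refine isProjectiveDesign_three_of_invariant stabilizerStates_finite stabilizerStates_nonempty
    ?_ fun U hU ρ hρ => stabilizerStates_conj hU hρ
  rintro ρ ⟨ψ, hψ, hρ, -⟩
  exact ⟨ψ, hψ, hρ⟩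

end Stabilizer

end QDesign

theorem mainTheorem4 (n : ℕ) :
    (∀ ρ : Matrix (QDesign.Bits n) (QDesign.Bits n) ℂ, QDesign.IsPureState ρ →
      QDesign.IsProjectiveDesign 3 (QDesign.cliffordOrbit ρ)) ∧
    QDesign.IsProjectiveDesign 3 (QDesign.stabilizerStates n) :=
  ⟨fun _ hρ => QDesign.isProjectiveDesign_three_cliffordOrbit hρ,
    QDesign.isProjectiveDesign_three_stabilizerStates⟩
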